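/- A permutation of length $n$ is a word containing each of $1,\ldots,n$ exactly once; a permutation $\sigma$ contains a (consecutive) occurrence of a pattern $\pi\in S_r$ at position $i$ if $\sigma_i\sigma_{i+1}\cdots\sigma_{i+r-1}$ is in the same relative order as $\pi$. For $k\ge 1$, a $k$-cluster of $\pi$ is a permutation $\sigma$ (of any length) together with positions $i_1<\cdots<i_k$ at which $\pi$ occurs in $\sigma$, such that $i_1=1$, $i_{j+1}<i_j+r$ for $1\le j<k$, and $\sigma$ has length $i_k+r-1$. Let $\pi_{n,k}$ be the number of permutations of length $n$ with exactly $k$ occurrences of $\pi$, and put $\Pi(x,t)=\sum_{n,k\ge 0}\pi_{n,k}\frac{x^n}{n!}t^k$, a formal power series. Two patterns are equivalent if for all $n$ and all $0\le k<n$ they have the same number $\pi_{n,k}$. Let $1\le a<m$, and for a permutation (word) $\tau$ of the numbers $a+2,\ldots,m+1$ consider the pattern $\pi=12\ldots a\,\tau\,(a+1)\in S_{m+1}$. Then: 1. for every $k\ge 1$, the number of $k$-clusters of $\pi$ is $\prod_{j=1}^k\binom{jm-a}{m-a}$; 2. the multiplicative inverse of the generating function $\Pi(x,t)$ of $\pi$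 is $$1-x-\sum_{k\ge1}\frac{(t-1)^k x^{km+1}}{(km+1)!}\prod_{j=1}^k\binom{jm-a}{m-a};$$ 3. for fixed $a$ and $m$, all these patterns, for different $\tau$, are equivalent to each other. -/

import Mathlib

open scoped PowerSeries

/-- The sequence `s` of distinct numbers has standardization `p`: its entries are in the same
relative order as those of `p`. (Entries and positions are numbered from `0`.) -/
def StandardizesTo {r : ℕ} (s : Fin r → ℕ) (p : Equiv.Perm (Fin r)) : Prop :=
  ∀ u v : Fin r, s u < s v ↔ p u < p v

/-- The consecutive pattern `p` of length `r` occurs in the permutation `σ` of length `n` at the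
positions `i, i + 1, …, i + r - 1`. -/
def OccursAt {r n : ℕ} (p : Equiv.Perm (Fin r)) (σ : Equiv.Perm (Fin n)) (i : ℕ) : Prop :=
  ∃ h : i + r ≤ n,
    StandardizesTo (fun u : Fin r => (σ ⟨i + u, by have := u.isLt; omega⟩ : ℕ)) p

/-- The number of occurrences of the consecutive pattern `p` in `σ`. -/
noncomputable def occurrences {r n : ℕ} (p : Equiv.Perm (Fin r)) (σ : Equiv.Perm (Fin n)) : ℕ :=
  Nat.card {i : ℕ // OccursAt p σ i}

/-- The number of permutations of length `n` with exactly `k` occurrences of `p`. -/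
noncomputable def permCount {r : ℕ} (p : Equiv.Perm (Fin r)) (n k : ℕ) : ℕ :=
  Nat.card {σ : Equiv.Perm (Fin n) // occurrences p σ = k}

/-- Two patterns are equivalent if for all `n` and all `0 ≤ k < n` equally many permutations of
length `n` have `k` occurrences of the one and of the other. -/
def PatternEquivalent {r s : ℕ} (p : Equiv.Perm (Fin r)) (q : Equiv.Perm (Fin s)) : Prop :=
  ∀ n k : ℕ, k < n → permCount p n k = permCount q n k

/-- The generating function `∑ π_{n,k} (x ^ n / n!) t ^ k`, as a formal power series in `x` with
coefficients in `ℚ⟦t⟧`. -/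
noncomputable def occurrenceSeries {r : ℕ} (p : Equiv.Perm (Fin r)) : ℚ⟦X⟧⟦X⟧ :=
  PowerSeries.mk fun n => PowerSeries.mk fun k => (permCount p n k : ℚ) / (n.factorial : ℚ)

/-- The `q`-clusters relative to the single pattern `p`: permutations `σ` of any length `n` with
`q ≥ 1` marked occurrences of `p`, listed from left to right, such that adjacent marked occurrences
overlap, the first one is at the beginning of `σ` and the last one at the end. -/
structure Cluster {r : ℕ} (p : Equiv.Perm (Fin r)) (q : ℕ) where
  n : ℕ
  σ : Equiv.Perm (Fin n)
  pos : Fin q → ℕ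
  q_pos : 0 < q
  occurs : ∀ k, OccursAt p σ (pos k)
  increasing : ∀ k l : Fin q, (k : ℕ) + 1 = l → pos k < pos l
  linked : ∀ k l : Fin q, (k : ℕ) + 1 = l → pos l < pos k + r
  starts : ∀ k : Fin q, (k : ℕ) = 0 → pos k = 0
  finishes : ∀ k : Fin q, (k : ℕ) + 1 = q → n = pos k + r

/-- The word `1 2 … a τ (a+1)` of length `m + 1`, where `τ` is a permutation of the numbers
`a + 2, …, m + 1`. With everything numbered from `0`, this is `0, …, a - 1`, then
`a + 1 + τ 0, …, a + 1 + τ (m - a - 1)`, then `a`. -/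
def riseWord {a m : ℕ} (h : a < m) (τ : Equiv.Perm (Fin (m - a))) (i : Fin (m + 1)) :
    Fin (m + 1) :=
  if (i : ℕ) < a then i
  else if hm : (i : ℕ) < m then
    ⟨a + 1 + τ ⟨(i : ℕ) - a, by omega⟩, by
      have := (τ ⟨(i : ℕ) - a, by omega⟩).isLt
      omega⟩
  else ⟨a, by omega⟩

theorem riseWord_injective {a m : ℕ} (h : a < m) (τ : Equiv.Perm (Fin (m - a))) :
    Function.Injective (riseWord h τ) := by
  intro i j hij
  have hi := i.isLt
  have hj := j.isLt
  unfold riseWord at hij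
  apply Fin.ext
  split_ifs at hij <;> simp only [Fin.ext_iff] at hij <;> try omega
  have h1 := τ.injective (Fin.ext (Nat.add_left_cancel hij))
  simp only [Fin.mk.injEq] at h1
  omega

/-- The pattern `1 2 … a τ (a+1)` as a permutation of length `m + 1`. -/
noncomputable def risePattern {a m : ℕ} (h : a < m) (τ : Equiv.Perm (Fin (m - a))) :
    Equiv.Perm (Fin (m + 1)) :=
  Equiv.ofBijective (riseWord h τ) (Finite.injective_iff_bijective.mp (riseWord_injective h τ))

/-- The product `∏_{j=1}^k binom (j m - a) (m - a)`. -/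
def binomProduct (a m k : ℕ) : ℕ :=
  ∏ j ∈ Finset.Icc 1 k, (j * m - a).choose (m - a)

/-- The formal power series `∑_{k ≥ 1} ((t-1)^k x^(km+1) / (km+1)!) ∏_{j=1}^k binom (jm-a) (m-a)`
in `x` with coefficients in `ℚ⟦t⟧`, for `m ≥ 1`: its coefficient at `x ^ n` collects the terms with
`k m + 1 = n` (which forces `k ≤ n`). -/
noncomputable def clusterTail (a m : ℕ) : ℚ⟦X⟧⟦X⟧ :=
  PowerSeries.mk fun n => ∑ k ∈ Finset.Icc 1 n with k * m + 1 = n,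
    PowerSeries.C ((binomProduct a m k : ℚ) / ((k * m + 1).factorial : ℚ)) *
      (PowerSeries.X - 1) ^ k

/-!
Write `t ^ occ σ = ((t - 1) + 1) ^ occ σ` as a sum over sets of marked occurrences in `σ`, and cut
`σ` at the first place that no marked occurrence straddles. The entries before the cut form a
cluster (a single entry, if there is no marked occurrence among them), those after it an arbitrary
permutation with an arbitrary set of marks, and the cut permutation is reassembled by choosing which
values come first. For exponential generating functions this is `Π = 1 + (x + C) Π`, where `C`
enumerates the clusters with the weight `(t - 1) ^ k`: the cluster theorem, valid for every pattern.

If occurrences of a pattern of length `m + 1` share at most one entry, a `k`-cluster is a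
permutation of length `k m + 1` with occurrences at the first `k` multiples of `m`. Suppose moreover
that the pattern begins with its minimum and ends with `a` (counting from `0`). Then the permutation
begins with `0`, and so does what remains of it, up to standardization, after its first `m` entries
are removed. Hence the entry at position `m` is the least of the remaining ones; as it ends the
first occurrence, it is `a`, and the first `m` entries are the values below `a` and any `m - a` of
the `(k m + 1) - (a + 1)` values above, in an order prescribed by the pattern. This gives the factor
`binom (k m - a) (m - a)`.
-/

section SplitPerm

open Finset

variable {a b : ℕ} (A : {A : Finset (Fin (a + b)) // #A = a}) (ρ : Equiv.Perm (Fin a))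
  (ρ' : Equiv.Perm (Fin b))

theorem card_compl_of_card_eq : #A.1ᶜ = b := by
  rw [card_compl, A.2, Fintype.card_fin, Nat.add_sub_cancel_left]

/-- The permutation of `Fin (a + b)` whose first `a` entries form the set `A` and are ordered like
`ρ`, and whose last `b` entries are ordered like `ρ'`. -/
def splitPerm : Equiv.Perm (Fin (a + b)) :=
  finSumFinEquiv.symm.trans
    ((Equiv.sumCongr ρ ρ').trans (finSumEquivOfFinset A.2 (card_compl_of_card_eq A)))

theorem splitPerm_castAdd (i : Fin a) :
    splitPerm A ρ ρ' (Fin.castAdd b i) = A.1.orderEmbOfFin A.2 (ρ i) := by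
  simp [splitPerm]

theorem splitPerm_natAdd (i : Fin b) :
    splitPerm A ρ ρ' (Fin.natAdd a i) = A.1ᶜ.orderEmbOfFin (card_compl_of_card_eq A) (ρ' i) := by
  simp [splitPerm]

theorem mem_iff_exists_splitPerm_castAdd (x : Fin (a + b)) :
    x ∈ A.1 ↔ ∃ i, splitPerm A ρ ρ' (Fin.castAdd b i) = x := by
  simp_rw [splitPerm_castAdd]
  rw [ρ.exists_congr_left, ← mem_coe, ← range_orderEmbOfFin A.1 A.2, Set.mem_range]
  simp only [Equiv.apply_symm_apply]

theorem splitPerm_bijective (a b : ℕ) :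
    Function.Bijective (fun x : {A : Finset (Fin (a + b)) // #A = a} ×
      Equiv.Perm (Fin a) × Equiv.Perm (Fin b) => splitPerm x.1 x.2.1 x.2.2) := by
  rw [Fintype.bijective_iff_injective_and_card]
  constructor
  · rintro ⟨A, ρ, ρ'⟩ ⟨B, η, η'⟩ h
    dsimp only at h
    obtain rfl : A = B := by
      ext x
      rw [mem_iff_exists_splitPerm_castAdd A ρ ρ', mem_iff_exists_splitPerm_castAdd B η η', h]
    obtain rfl : ρ = η := Equiv.ext fun i => by
      simpa only [splitPerm_castAdd, EmbeddingLike.apply_eq_iff_eq] using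
        congrArg (fun σ => σ (Fin.castAdd b i)) h
    obtain rfl : ρ' = η' := Equiv.ext fun i => by
      simpa only [splitPerm_natAdd, EmbeddingLike.apply_eq_iff_eq] using
        congrArg (fun σ => σ (Fin.natAdd a i)) h
    rfl
  · simp only [Fintype.card_prod, Fintype.card_finset_len, Fintype.card_perm, Fintype.card_fin]
    rw [← mul_assoc, Nat.choose_symm_add, Nat.add_choose_mul_factorial_mul_factorial]

theorem sum_perm_of_splitPerm {R : Type*} [CommSemiring R] {a b : ℕ}
    {F : Equiv.Perm (Fin (a + b)) → R} {G : Equiv.Perm (Fin a) → R} {H : Equiv.Perm (Fin b) → R}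
    (h : ∀ A ρ ρ', F (splitPerm A ρ ρ') = G ρ * H ρ') :
    ∑ σ, F σ = ((a + b).choose a : R) * ((∑ ρ, G ρ) * ∑ ρ', H ρ') := by
  rw [← (splitPerm_bijective a b).sum_comp F]
  simp_rw [h, Fintype.sum_prod_type]
  rw [sum_const, card_univ, Fintype.card_finset_len, Fintype.card_fin, nsmul_eq_mul, sum_mul_sum]

end SplitPerm

section Occurrences

open Finset

variable {r : ℕ} (p : Equiv.Perm (Fin r))

theorem occursAt_iff_of_orderEmbedding {n n' : ℕ} {σ : Equiv.Perm (Fin n)}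
    {σ' : Equiv.Perm (Fin n')} {i i' : ℕ} (hi : i + r ≤ n) (hi' : i' + r ≤ n')
    (f : Fin n' ↪o Fin n)
    (hf : ∀ u : Fin r, σ ⟨i + u, by omega⟩ = f (σ' ⟨i' + u, by omega⟩)) :
    OccursAt p σ i ↔ OccursAt p σ' i' := by
  simp only [OccursAt, StandardizesTo, hi, hi', hf, exists_true_left, Fin.val_fin_lt,
    OrderEmbedding.lt_iff_lt]

theorem OccursAt.lt_iff {p : Equiv.Perm (Fin r)} {n : ℕ} {σ : Equiv.Perm (Fin n)} {i x y : ℕ}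
    (h : OccursAt p σ i) (hx : i ≤ x) (hy : i ≤ y) (hxr : x < i + r) (hyr : y < i + r)
    (hxn : x < n) (hyn : y < n) :
    σ ⟨x, hxn⟩ < σ ⟨y, hyn⟩ ↔ p ⟨x - i, by omega⟩ < p ⟨y - i, by omega⟩ := by
  obtain ⟨_, hs⟩ := h
  rw [← hs]
  simp only [Nat.add_sub_cancel' hx, Nat.add_sub_cancel' hy, Fin.val_fin_lt]

theorem finite_setOf_occursAt {n : ℕ} (σ : Equiv.Perm (Fin n)) : {i | OccursAt p σ i}.Finite :=
  (Set.finite_Iic n).subset fun _ ⟨h, _⟩ => (Nat.le_add_right _ _).trans h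

/-- The positions at which `p` occurs in `σ`, as a `Finset`. -/
noncomputable def occurrencePositions {n : ℕ} (σ : Equiv.Perm (Fin n)) : Finset ℕ :=
  (finite_setOf_occursAt p σ).toFinset

variable {p} in
theorem mem_occurrencePositions {n : ℕ} {σ : Equiv.Perm (Fin n)} {i : ℕ} :
    i ∈ occurrencePositions p σ ↔ OccursAt p σ i :=
  Set.Finite.mem_toFinset _

theorem occurrences_eq_card {n : ℕ} (σ : Equiv.Perm (Fin n)) :
    occurrences p σ = #(occurrencePositions p σ) :=
  Set.ncard_eq_toFinset_card _ (finite_setOf_occursAt p σ)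

theorem add_le_of_mem_occurrencePositions {n : ℕ} (σ : Equiv.Perm (Fin n)) :
    ∀ i ∈ occurrencePositions p σ, i + r ≤ n :=
  fun _ hi => (mem_occurrencePositions.mp hi).1

section

variable {a b : ℕ} (A : {A : Finset (Fin (a + b)) // #A = a}) (ρ : Equiv.Perm (Fin a))
  (ρ' : Equiv.Perm (Fin b))

theorem occursAt_splitPerm_left {i : ℕ} (hi : i + r ≤ a) :
    OccursAt p (splitPerm A ρ ρ') i ↔ OccursAt p ρ i :=
  occursAt_iff_of_orderEmbedding p (by omega) hi (A.1.orderEmbOfFin A.2) fun u =>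
    splitPerm_castAdd A ρ ρ' ⟨i + u, by omega⟩

theorem occursAt_splitPerm_right (i : ℕ) :
    OccursAt p (splitPerm A ρ ρ') (a + i) ↔ OccursAt p ρ' i := by
  by_cases hi : i + r ≤ b
  · refine occursAt_iff_of_orderEmbedding p (by omega) hi
      (A.1ᶜ.orderEmbOfFin (card_compl_of_card_eq A)) fun u => ?_
    rw [← splitPerm_natAdd A ρ ρ']
    exact congrArg _ (Fin.ext (Nat.add_assoc _ _ _))
  · exact iff_of_false (fun h => hi (by have := h.1; omega)) fun h => hi h.1

theorem filter_add_le_occurrencePositions_splitPerm :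
    {i ∈ occurrencePositions p (splitPerm A ρ ρ') | i + r ≤ a} = occurrencePositions p ρ := by
  ext i
  rw [mem_filter, mem_occurrencePositions, mem_occurrencePositions]
  constructor
  · rintro ⟨hσ, hi⟩
    exact (occursAt_splitPerm_left p A ρ ρ' hi).mp hσ
  · intro hρ
    exact ⟨(occursAt_splitPerm_left p A ρ ρ' hρ.1).mpr hρ, hρ.1⟩

theorem card_filter_le_occurrencePositions_splitPerm :
    #{i ∈ occurrencePositions p (splitPerm A ρ ρ') | a ≤ i} = occurrences p ρ' := by
  rw [occurrences_eq_card, ← card_map (addLeftEmbedding a) (s := occurrencePositions p ρ')]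
  congr 1
  ext i
  simp only [mem_filter, mem_map, mem_occurrencePositions, addLeftEmbedding_apply]
  constructor
  · rintro ⟨hσ, hi⟩
    obtain ⟨j, rfl⟩ := Nat.exists_eq_add_of_le hi
    exact ⟨j, (occursAt_splitPerm_right p A ρ ρ' j).mp hσ, rfl⟩
  · rintro ⟨j, hj, rfl⟩
    exact ⟨(occursAt_splitPerm_right p A ρ ρ' j).mpr hj, Nat.le_add_right a j⟩

end

end Occurrences

section FirstBreak

open Finset

/-- The places `ℓ > 0` at which none of the intervals `[i, i + r)`, `i ∈ S`, is cut in two. -/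
def breaks (r : ℕ) (S : Finset ℕ) : Set ℕ :=
  {ℓ | 0 < ℓ ∧ ∀ i ∈ S, i < ℓ → i + r ≤ ℓ}

/-- The first break of a set of marked intervals of length `r`: a set of marked occurrences forms a
cluster of length `n` exactly if its first break is at `n`. -/
noncomputable def firstBreak (r : ℕ) (S : Finset ℕ) : ℕ :=
  sInf (breaks r S)

variable {r n : ℕ} {S : Finset ℕ}

theorem mem_breaks_of_forall_add_le (hn : 0 < n) (h : ∀ i ∈ S, i + r ≤ n) : n ∈ breaks r S :=
  ⟨hn, fun i hi _ => h i hi⟩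

variable (r S) in
theorem isLeast_firstBreak : IsLeast (breaks r S) (firstBreak r S) := by
  have hne : (breaks r S).Nonempty :=
    ⟨S.sup id + r + 1, mem_breaks_of_forall_add_le (Nat.succ_pos _) fun i hi => by
      have : i ≤ S.sup id := le_sup (f := id) hi
      omega⟩
  exact ⟨Nat.sInf_mem hne, fun _ => Nat.sInf_le⟩

theorem firstBreak_eq_iff : firstBreak r S = n ↔ IsLeast (breaks r S) n :=
  (isLeast_firstBreak r S).isLeast_iff_eq.symm

variable (r S) in
theorem firstBreak_pos : 0 < firstBreak r S :=
  (isLeast_firstBreak r S).1.1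

theorem firstBreak_le (hn : 0 < n) (h : ∀ i ∈ S, i + r ≤ n) : firstBreak r S ≤ n :=
  (isLeast_firstBreak r S).2 (mem_breaks_of_forall_add_le hn h)

variable (r) in
theorem firstBreak_empty : firstBreak r ∅ = 1 :=
  le_antisymm (firstBreak_le one_pos (by simp)) (firstBreak_pos r ∅)

theorem firstBreak_eq_of_forall_lt_mem_iff {S' : Finset ℕ} (h : firstBreak r S = n)
    (hS : ∀ i < n, i ∈ S' ↔ i ∈ S) : firstBreak r S' = n := by
  rw [firstBreak_eq_iff] at h ⊢
  have hbreaks : ∀ j ≤ n, j ∈ breaks r S' ↔ j ∈ breaks r S := fun j hj =>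
    and_congr_right fun _ => forall_congr' fun i =>
      ⟨fun H hi hij => H ((hS i (by omega)).mpr hi) hij,
        fun H hi hij => H ((hS i (by omega)).mp hi) hij⟩
  refine ⟨(hbreaks n le_rfl).mpr h.1, fun j hj => ?_⟩
  by_contra! hjn
  exact hjn.not_ge (h.2 ((hbreaks j hjn.le).mp hj))

/-- Such a set `S` consists of a part before `ℓ`, which already has its first break at `ℓ`, and of
an arbitrary part from `ℓ` on. -/
theorem sum_powerset_firstBreak_eq {R : Type*} [CommSemiring R] (hr : 0 < r) (O : Finset ℕ)
    (u : R) (ℓ : ℕ) :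
    ∑ S ∈ O.powerset with firstBreak r S = ℓ, u ^ #S =
      (∑ S ∈ {i ∈ O | i + r ≤ ℓ}.powerset with firstBreak r S = ℓ, u ^ #S) *
        (u + 1) ^ #{i ∈ O | ℓ ≤ i} := by
  rw [← sum_pow_mul_eq_add_pow, sum_mul_sum, ← sum_product']
  simp_rw [one_pow, mul_one, ← pow_add]
  symm
  refine sum_nbij' (fun x => x.1 ∪ x.2) (fun S => ({i ∈ S | i < ℓ}, {i ∈ S | ℓ ≤ i}))
    ?_ ?_ ?_ ?_ ?_
  · rintro ⟨S, T⟩ h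
    simp only [mem_product, mem_filter, mem_powerset, subset_iff, mem_union] at h ⊢
    refine ⟨by grind, firstBreak_eq_of_forall_lt_mem_iff h.1.2 (by grind)⟩
  · intro S h
    simp only [mem_product, mem_filter, mem_powerset, subset_iff] at h ⊢
    have hbreak := (isLeast_firstBreak r S).1.2
    refine ⟨⟨by grind, firstBreak_eq_of_forall_lt_mem_iff h.2 (by grind)⟩, by grind⟩
  · rintro ⟨S, T⟩ h
    simp only [mem_product, mem_filter, mem_powerset, subset_iff] at h
    ext i <;> simp only [mem_filter, mem_union] <;> grind
  · intro S _
    ext i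
    grind
  · rintro ⟨S, T⟩ h
    simp only [mem_product, mem_filter, mem_powerset, subset_iff] at h
    rw [card_union_of_disjoint (disjoint_left.mpr (by grind))]

theorem add_one_pow_card_eq_sum_firstBreak {R : Type*} [CommSemiring R] (hr : 0 < r) (hn : 0 < n)
    {O : Finset ℕ} (hO : ∀ i ∈ O, i + r ≤ n) (u : R) :
    (u + 1) ^ #O = ∑ ℓ ∈ range (n + 1),
      (∑ S ∈ {i ∈ O | i + r ≤ ℓ}.powerset with firstBreak r S = ℓ, u ^ #S) *
        (u + 1) ^ #{i ∈ O | ℓ ≤ i} := by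
  have hmem : ∀ S ∈ O.powerset, firstBreak r S ∈ range (n + 1) := fun S hS =>
    mem_range_succ_iff.mpr (firstBreak_le hn fun i hi => hO i (mem_powerset.mp hS hi))
  calc (u + 1) ^ #O = ∑ S ∈ O.powerset, u ^ #S := by simp [← sum_pow_mul_eq_add_pow]
    _ = ∑ ℓ ∈ range (n + 1), ∑ S ∈ O.powerset with firstBreak r S = ℓ, u ^ #S :=
      (sum_fiberwise_of_maps_to hmem _).symm
    _ = _ := sum_congr rfl fun ℓ _ => sum_powerset_firstBreak_eq hr O u ℓ

end FirstBreak

section ClusterSum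

open Finset

variable {r : ℕ} (p : Equiv.Perm (Fin r))

/-- The sets of occurrences of `p` in `σ` that make `σ` a cluster. The empty set is admitted when
`σ` has length `1`, so that single entries count as clusters without marked occurrences. -/
noncomputable def clusterMarkings {n : ℕ} (σ : Equiv.Perm (Fin n)) : Finset (Finset ℕ) :=
  {S ∈ (occurrencePositions p σ).powerset | firstBreak r S = n}

/-- The enumerator of the permutations of length `n` by the number of occurrences of `p`, at the
value `t` of the counting variable. -/
noncomputable def occurrenceSum {R : Type*} [CommSemiring R] (t : R) (n : ℕ) : R :=
  ∑ σ : Equiv.Perm (Fin n), t ^ occurrences p σ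

/-- The enumerator of the clusters of length `n`, single entries included, by the number of marked
occurrences of `p`, at the value `u` of the counting variable. -/
noncomputable def clusterSum {R : Type*} [CommSemiring R] (u : R) (n : ℕ) : R :=
  ∑ σ : Equiv.Perm (Fin n), ∑ S ∈ clusterMarkings p σ, u ^ #S

variable {p}

theorem mem_clusterMarkings {n : ℕ} {σ : Equiv.Perm (Fin n)} {S : Finset ℕ} :
    S ∈ clusterMarkings p σ ↔ (∀ i ∈ S, OccursAt p σ i) ∧ firstBreak r S = n := by
  simp only [clusterMarkings, mem_filter, mem_powerset, subset_iff, mem_occurrencePositions]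

theorem card_le_of_mem_clusterMarkings (hr : 0 < r) {n : ℕ} {σ : Equiv.Perm (Fin n)}
    {S : Finset ℕ} (hS : S ∈ clusterMarkings p σ) : #S ≤ n := by
  have hsub : S ⊆ range n := fun i hi => by
    have := ((mem_clusterMarkings.mp hS).1 i hi).1
    exact mem_range.mpr (by omega)
  simpa using card_le_card hsub

variable {R : Type*} [CommSemiring R] (u : R)

variable (p) in
theorem occurrenceSum_zero (hr : 0 < r) (t : R) : occurrenceSum p t 0 = 1 := by
  have hnone : ∀ σ : Equiv.Perm (Fin 0), occurrences p σ = 0 := fun σ => by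
    rw [occurrences_eq_card, card_eq_zero, eq_empty_iff_forall_notMem]
    intro i hi
    have := add_le_of_mem_occurrencePositions p σ i hi
    omega
  simp [occurrenceSum, hnone]

variable (p) in
theorem clusterSum_zero : clusterSum p u 0 = 0 := by
  refine sum_eq_zero fun σ _ => ?_
  rw [clusterMarkings, filter_false_of_mem fun S _ => (firstBreak_pos r S).ne', sum_empty]

variable (p) in
/-- Expand `(u + 1) ^ occurrences p σ` over sets of marked occurrences and cut `σ` at the first
break of the marked set: what comes before is a cluster, what comes after is arbitrary. -/
theorem occurrenceSum_add_one (hr : 0 < r) {n : ℕ} (hn : 0 < n) :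
    occurrenceSum p (u + 1) n = ∑ ℓ ∈ range (n + 1),
      (n.choose ℓ : R) * (clusterSum p u ℓ * occurrenceSum p (u + 1) (n - ℓ)) := by
  simp_rw [occurrenceSum, occurrences_eq_card, add_one_pow_card_eq_sum_firstBreak hr hn
    (add_le_of_mem_occurrencePositions p _)]
  rw [sum_comm]
  refine sum_congr rfl fun ℓ hℓ => ?_
  obtain ⟨b, rfl⟩ := Nat.exists_eq_add_of_le (mem_range_succ_iff.mp hℓ)
  rw [Nat.add_sub_cancel_left]
  refine sum_perm_of_splitPerm fun A ρ ρ' => ?_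
  rw [filter_add_le_occurrencePositions_splitPerm, card_filter_le_occurrencePositions_splitPerm,
    occurrences_eq_card]
  rfl

end ClusterSum

section ExponentialGeneratingFunction

open Finset

/-- The exponential generating function `∑ f n x ^ n / n!`. -/
noncomputable def egf {R : Type*} [CommSemiring R] [Algebra ℚ R] (f : ℕ → R) : R⟦X⟧ :=
  PowerSeries.mk fun n => (n.factorial : ℚ)⁻¹ • f n

variable {R : Type*} [CommRing R] [Algebra ℚ R]

theorem egf_mul_egf (f g : ℕ → R) :
    egf f * egf g = egf fun n => ∑ i ∈ range (n + 1), (n.choose i : R) * (f i * g (n - i)) := by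
  ext n
  rw [PowerSeries.coeff_mul, Nat.sum_antidiagonal_eq_sum_range_succ_mk]
  simp only [egf, PowerSeries.coeff_mk, smul_sum]
  refine sum_congr rfl fun i hi => ?_
  have hchoose : (n.factorial : ℚ)⁻¹ * n.choose i =
      (i.factorial : ℚ)⁻¹ * ((n - i).factorial : ℚ)⁻¹ := by
    rw [Nat.cast_choose ℚ (mem_range_succ_iff.mp hi)]
    have := n.factorial_ne_zero
    field_simp
  rw [smul_mul_smul_comm, ← hchoose, mul_smul, ← nsmul_eq_mul, Nat.cast_smul_eq_nsmul]

theorem egf_occurrenceSum_mul_one_sub_egf_clusterSum {r : ℕ} (hr : 0 < r)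
    (p : Equiv.Perm (Fin r)) (u : R) :
    egf (occurrenceSum p (u + 1)) * (1 - egf (clusterSum p u)) = 1 := by
  rw [mul_sub, mul_one, sub_eq_iff_eq_add, mul_comm, egf_mul_egf]
  ext n
  rcases Nat.eq_zero_or_pos n with rfl | hn
  · simp [egf, occurrenceSum_zero p hr, clusterSum_zero]
  · rw [map_add, PowerSeries.coeff_one, if_neg hn.ne', zero_add]
    simp only [egf, PowerSeries.coeff_mk, ← occurrenceSum_add_one p u hr hn]

end ExponentialGeneratingFunction

section Cluster

open Finset

variable {r : ℕ} {p : Equiv.Perm (Fin r)} {k : ℕ}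

theorem Cluster.strictMono_pos (c : Cluster p k) : StrictMono c.pos := by
  obtain ⟨k, rfl⟩ := Nat.exists_eq_add_one_of_ne_zero c.q_pos.ne'
  exact Fin.strictMono_iff_lt_succ.mpr fun i => c.increasing _ _ rfl

theorem Cluster.firstBreak_image_pos (hr : 0 < r) (c : Cluster p k) :
    firstBreak r (univ.image c.pos) = c.n := by
  have hk := c.q_pos
  rw [firstBreak_eq_iff]
  refine ⟨mem_breaks_of_forall_add_le ?_ (by simpa using fun i => (c.occurs i).1), ?_⟩
  · have := c.finishes ⟨k - 1, by omega⟩ (Nat.sub_add_cancel hk)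
    omega
  rintro ℓ ⟨hℓ, hcut⟩
  replace hcut : ∀ i, c.pos i < ℓ → c.pos i + r ≤ ℓ := by simpa using hcut
  have hle : ∀ i (hi : i < k), c.pos ⟨i, hi⟩ + r ≤ ℓ := by
    intro i hi
    induction i with
    | zero => exact hcut _ ((c.starts ⟨0, hi⟩ rfl).trans_lt hℓ)
    | succ i ih => exact hcut _ ((c.linked ⟨i, by omega⟩ ⟨i + 1, hi⟩ rfl).trans_le (ih _))
  exact (c.finishes ⟨k - 1, by omega⟩ (Nat.sub_add_cancel hk)).trans_le (hle _ _)

theorem le_of_mem_clusterMarkings {n : ℕ} {σ : Equiv.Perm (Fin n)} {S : Finset ℕ}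
    (hS : S ∈ clusterMarkings p σ) (hSk : #S = k) {ℓ : ℕ} (hℓ : 0 < ℓ)
    (hcut : ∀ i, S.orderEmbOfFin hSk i < ℓ → S.orderEmbOfFin hSk i + r ≤ ℓ) : n ≤ ℓ := by
  have hleast : IsLeast (breaks r S) n := firstBreak_eq_iff.mp (mem_clusterMarkings.mp hS).2
  refine hleast.2 ⟨hℓ, fun i hi => ?_⟩
  rw [← mem_coe, ← S.range_orderEmbOfFin hSk] at hi
  obtain ⟨j, rfl⟩ := hi
  exact hcut j

/-- The cluster made of a permutation and a set of marked occurrences. -/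
def clusterOfMarking (hr : 0 < r) (hk : 0 < k) {n : ℕ} (σ : Equiv.Perm (Fin n)) {S : Finset ℕ}
    (hS : S ∈ clusterMarkings p σ) (hSk : #S = k) : Cluster p k :=
  let pos : Fin k ↪o ℕ := S.orderEmbOfFin hSk
  have hocc : ∀ i, OccursAt p σ (pos i) := fun i =>
    (mem_clusterMarkings.mp hS).1 _ (S.orderEmbOfFin_mem hSk i)
  have hlength : ∀ {ℓ}, 0 < ℓ → (∀ i, pos i < ℓ → pos i + r ≤ ℓ) → n ≤ ℓ :=
    le_of_mem_clusterMarkings hS hSk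
  { n := n
    σ := σ
    pos := pos
    q_pos := hk
    occurs := hocc
    increasing := fun i j hij => pos.strictMono (Fin.lt_def.mpr (by omega))
    linked := fun i j hij => by
      by_contra! hlt
      have := (hocc j).1
      have := hlength (ℓ := pos j) (by omega) fun l hl => by
        have := Fin.lt_def.mp (pos.lt_iff_lt.mp hl)
        have := pos.monotone (Fin.le_def.mpr (by omega) : l ≤ i)
        omega
      omega
    starts := fun i hi => by
      by_contra hpos
      have := (hocc i).1
      have := hlength (Nat.pos_of_ne_zero hpos) fun l hl => by
        have := Fin.lt_def.mp (pos.lt_iff_lt.mp hl)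
        omega
      omega
    finishes := fun i hi => by
      refine le_antisymm (hlength (by omega) fun l _ => ?_) (hocc i).1
      have := pos.monotone (Fin.le_def.mpr (by omega) : l ≤ i)
      omega }

theorem card_cluster_of_length (hr : 0 < r) (hk : 0 < k) (n : ℕ) :
    Nat.card {c : Cluster p k // c.n = n} =
      ∑ σ : Equiv.Perm (Fin n), #{S ∈ clusterMarkings p σ | #S = k} := by
  let toCluster : (Σ σ : Equiv.Perm (Fin n), {S // S ∈ {S ∈ clusterMarkings p σ | #S = k}}) →
      {c : Cluster p k // c.n = n} := fun x =>
    ⟨clusterOfMarking hr hk x.1 (mem_filter.mp x.2.2).1 (mem_filter.mp x.2.2).2, rfl⟩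
  have hbij : Function.Bijective toCluster := by
    constructor
    · rintro ⟨σ, S, hS⟩ ⟨σ', S', hS'⟩ heq
      have hSk := (mem_filter.mp hS).2
      have hSk' := (mem_filter.mp hS').2
      simp only [toCluster, clusterOfMarking, Subtype.mk.injEq, Cluster.mk.injEq, heq_eq_eq,
        true_and] at heq
      obtain ⟨rfl, hpos⟩ := heq
      obtain rfl : S = S' := by
        rw [← coe_inj, ← S.range_orderEmbOfFin hSk, ← S'.range_orderEmbOfFin hSk', hpos]
      rfl
    · rintro ⟨c, rfl⟩
      have hcard : #(univ.image c.pos) = k := by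
        rw [card_image_of_injective _ c.strictMono_pos.injective, card_univ, Fintype.card_fin]
      have hmem : univ.image c.pos ∈ clusterMarkings p c.σ :=
        mem_clusterMarkings.mpr ⟨by simpa using c.occurs, c.firstBreak_image_pos hr⟩
      refine ⟨⟨c.σ, univ.image c.pos, mem_filter.mpr ⟨hmem, hcard⟩⟩, ?_⟩
      have hpos : c.pos = (univ.image c.pos).orderEmbOfFin hcard :=
        orderEmbOfFin_unique hcard (fun i => mem_image_of_mem _ (mem_univ i)) c.strictMono_pos
      simp only [toCluster, clusterOfMarking, ← hpos]
  rw [← Nat.card_eq_of_bijective _ hbij, Nat.card_sigma]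
  simp only [Nat.card_eq_fintype_card, Fintype.card_coe]

variable (p) in
theorem sum_card_clusterMarkings_card_zero (n : ℕ) :
    ∑ σ : Equiv.Perm (Fin n), #{S ∈ clusterMarkings p σ | #S = 0} = if n = 1 then 1 else 0 := by
  have hfilter : ∀ σ : Equiv.Perm (Fin n),
      {S ∈ clusterMarkings p σ | #S = 0} = if n = 1 then {∅} else ∅ := by
    intro σ
    ext S
    split_ifs <;> simp only [mem_filter, mem_clusterMarkings, card_eq_zero] <;>
      grind [firstBreak_empty]
  simp_rw [hfilter]
  split_ifs with hn
  · subst hn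
    simp
  · simp

variable (p) in
theorem clusterSum_eq (hr : 0 < r) {R : Type*} [CommSemiring R] (u : R) (n : ℕ) :
    clusterSum p u n = (if n = 1 then 1 else 0) +
      ∑ k ∈ Icc 1 n, (Nat.card {c : Cluster p k // c.n = n} : R) * u ^ k := by
  have hcard : ∀ σ : Equiv.Perm (Fin n), ∀ S ∈ clusterMarkings p σ, #S ∈ Icc 0 n :=
    fun σ S hS => mem_Icc.mpr ⟨Nat.zero_le _, card_le_of_mem_clusterMarkings hr hS⟩
  calc clusterSum p u n
      = ∑ k ∈ Icc 0 n, (∑ σ : Equiv.Perm (Fin n), #{S ∈ clusterMarkings p σ | #S = k} : ℕ) *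
          u ^ k := by
        simp_rw [clusterSum, ← sum_fiberwise_of_maps_to (hcard _), Nat.cast_sum, sum_mul]
        rw [sum_comm]
        refine sum_congr rfl fun k _ => sum_congr rfl fun σ _ => ?_
        rw [← nsmul_eq_mul, ← sum_const]
        exact sum_congr rfl fun S hS => by rw [(mem_filter.mp hS).2]
    _ = _ := by
        rw [← insert_Icc_succ_left_eq_Icc n.zero_le, sum_insert (by simp),
          sum_card_clusterMarkings_card_zero]
        simp only [pow_zero, mul_one, Nat.cast_ite, Nat.cast_one, Nat.cast_zero]
        congr 1
        exact sum_congr rfl fun k hk => by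
          rw [card_cluster_of_length hr (mem_Icc.mp hk).1]

end Cluster

section ClusterTheorem

open Finset

variable {r : ℕ} (p : Equiv.Perm (Fin r))

theorem occurrenceSum_X (n : ℕ) :
    occurrenceSum p (PowerSeries.X : ℚ⟦X⟧) n = PowerSeries.mk fun k => (permCount p n k : ℚ) := by
  ext k
  rw [occurrenceSum, map_sum, PowerSeries.coeff_mk, permCount, Nat.card_eq_fintype_card,
    Fintype.card_subtype]
  simp only [PowerSeries.coeff_X_pow, sum_boole, eq_comm]

theorem occurrenceSeries_eq_egf :
    occurrenceSeries p = egf (occurrenceSum p (PowerSeries.X : ℚ⟦X⟧)) := by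
  ext n k
  simp only [occurrenceSeries, egf, occurrenceSum_X, PowerSeries.coeff_mk, PowerSeries.coeff_smul,
    smul_eq_mul, div_eq_inv_mul]

/-- The exponential generating function of the clusters of `p` by length, where a cluster with `k`
marked occurrences has the weight `(t - 1) ^ k`. A cluster of length `n` has at most `n` marked
occurrences if `p` is not empty. -/
noncomputable def clusterSeries : ℚ⟦X⟧⟦X⟧ :=
  PowerSeries.mk fun n => ∑ k ∈ Icc 1 n,
    PowerSeries.C ((Nat.card {c : Cluster p k // c.n = n} : ℚ) / (n.factorial : ℚ)) *
      (PowerSeries.X - 1) ^ k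

theorem egf_clusterSum_eq (hr : 0 < r) :
    egf (clusterSum p (PowerSeries.X - 1 : ℚ⟦X⟧)) = PowerSeries.X + clusterSeries p := by
  ext1 n
  simp only [egf, clusterSeries, map_add, PowerSeries.coeff_mk, PowerSeries.coeff_X,
    clusterSum_eq p hr, smul_add, smul_sum]
  congr 1
  · split_ifs with hn
    · simp [hn]
    · rw [smul_zero]
  · refine sum_congr rfl fun k _ => ?_
    rw [PowerSeries.smul_eq_C_mul, ← mul_assoc, div_eq_inv_mul, map_mul, map_natCast]

/-- The cluster theorem of Goulden and Jackson, for a single pattern. -/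
theorem occurrenceSeries_mul_one_sub_clusterSeries (hr : 0 < r) :
    occurrenceSeries p * (1 - PowerSeries.X - clusterSeries p) = 1 := by
  rw [occurrenceSeries_eq_egf, sub_sub, ← egf_clusterSum_eq p hr]
  have hmul := egf_occurrenceSum_mul_one_sub_egf_clusterSum hr p (PowerSeries.X - 1 : ℚ⟦X⟧)
  rwa [sub_add_cancel] at hmul

variable {p} in
theorem patternEquivalent_of_occurrenceSeries_eq {s : ℕ} {q : Equiv.Perm (Fin s)}
    (h : occurrenceSeries p = occurrenceSeries q) : PatternEquivalent p q := by
  intro n k _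
  have hcoeff := congrArg (fun f => PowerSeries.coeff k (PowerSeries.coeff n f)) h
  simp only [occurrenceSeries, PowerSeries.coeff_mk] at hcoeff
  rw [div_left_inj' (Nat.cast_ne_zero.mpr n.factorial_ne_zero)] at hcoeff
  exact_mod_cast hcoeff

end ClusterTheorem

section PrefixOccurrence

open Finset

theorem StandardizesTo.strictMono_comp_symm {r : ℕ} {s : Fin r → ℕ} {p : Equiv.Perm (Fin r)}
    (hp : StandardizesTo s p) : StrictMono (s ∘ p.symm) := fun x y hxy => by
  rwa [Function.comp_apply, Function.comp_apply, hp, p.apply_symm_apply, p.apply_symm_apply]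

theorem StandardizesTo.unique {r : ℕ} {s : Fin r → ℕ} {p q : Equiv.Perm (Fin r)}
    (hp : StandardizesTo s p) (hq : StandardizesTo s q) : p = q := by
  have heq : s ∘ p.symm = s ∘ q.symm :=
    (hp.strictMono_comp_symm.range_inj hq.strictMono_comp_symm).mp
      (by rw [p.symm.surjective.range_comp, q.symm.surjective.range_comp])
  have hs : Function.Injective s :=
    (EquivLike.injective_comp p.symm s).mp hp.strictMono_comp_symm.injective
  exact Equiv.symm_bijective.injective (Equiv.ext fun x => hs (congrFun heq x))

variable {m : ℕ} (p : Equiv.Perm (Fin (m + 1)))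

/-- The standardization of `p` without its last entry. -/
def initPerm : Equiv.Perm (Fin m) :=
  (finSuccAboveEquiv (Fin.last m)).trans
    ((p.subtypeEquiv fun _ => p.apply_eq_iff_eq.not.symm).trans
      (finSuccAboveEquiv (p (Fin.last m))).symm)

theorem succAbove_initPerm (u : Fin m) :
    (p (Fin.last m)).succAbove (initPerm p u) = p u.castSucc := by
  rw [← Fin.succAbove_last_apply u]
  exact congrArg Subtype.val ((finSuccAboveEquiv (p (Fin.last m))).apply_symm_apply _)

theorem standardizesTo_iff_initPerm {s : Fin (m + 1) → ℕ} (hs : Function.Injective s) :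
    StandardizesTo s p ↔ StandardizesTo (fun u : Fin m => s u.castSucc) (initPerm p) ∧
      ∀ u : Fin m, s u.castSucc < s (Fin.last m) ↔
        (initPerm p u).castSucc < p (Fin.last m) := by
  have hlast : ∀ u : Fin m, (initPerm p u).castSucc < p (Fin.last m) ↔
      p u.castSucc < p (Fin.last m) := fun u => by
    rw [← succAbove_initPerm, Fin.succAbove_lt_iff_castSucc_lt]
  have hinit : ∀ u v : Fin m, initPerm p u < initPerm p v ↔ p u.castSucc < p v.castSucc :=
    fun u v => by
      rw [← succAbove_initPerm, ← succAbove_initPerm, Fin.succAbove_lt_succAbove_iff]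
  simp only [StandardizesTo, Fin.forall_fin_succ', hlast, hinit, lt_self_iff_false, and_true]
  refine ⟨fun h => ⟨fun u => (h.1 u).1, fun u => (h.1 u).2⟩,
    fun h => ⟨fun u => ⟨h.1 u, h.2 u⟩, fun u => ?_⟩⟩
  have hne := p.injective.ne u.castSucc_ne_last
  have hsne := hs.ne u.castSucc_ne_last
  have := h.2 u
  grind

section

variable {N : ℕ} {A : Finset (Fin N)} {c : Fin N}

theorem isLeast_compl_iff : IsLeast (↑Aᶜ : Set (Fin N)) c ↔ Iio c ⊆ A ∧ c ∉ A := by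
  simp only [IsLeast, mem_lowerBounds, coe_compl, Set.mem_compl_iff, mem_coe, subset_iff, mem_Iio]
  grind

theorem le_card_of_isLeast_compl (hc : IsLeast (↑Aᶜ : Set (Fin N)) c) : (c : ℕ) ≤ #A := by
  simpa using card_le_card (isLeast_compl_iff.mp hc).1

theorem orderEmbOfFin_lt_iff_of_isLeast_compl (hA : #A = m)
    (hc : IsLeast (↑Aᶜ : Set (Fin N)) c) (i : Fin m) :
    A.orderEmbOfFin hA i < c ↔ (i : ℕ) < c := by
  rw [isLeast_compl_iff] at hc
  constructor
  · intro hi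
    have hsub : (Iic i).map (A.orderEmbOfFin hA).toEmbedding ⊆ Iio c := by
      simp only [subset_iff, mem_map, mem_Iic, mem_Iio]
      rintro _ ⟨j, hj, rfl⟩
      exact ((A.orderEmbOfFin hA).monotone hj).trans_lt hi
    simpa using card_le_card hsub
  · contrapose!
    intro hi
    have hsub : Iio c ⊆ (Iio i).map (A.orderEmbOfFin hA).toEmbedding := by
      intro x hx
      obtain ⟨j, rfl⟩ : x ∈ Set.range (A.orderEmbOfFin hA) := by
        rw [range_orderEmbOfFin]
        exact hc.1 hx
      exact mem_map_of_mem _ (mem_Iio.mpr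
        ((A.orderEmbOfFin hA).lt_iff_lt.mp ((mem_Iio.mp hx).trans_le hi)))
    simpa using card_le_card hsub

theorem card_finset_isLeast_compl (hc : (c : ℕ) ≤ m) :
    Nat.card {A : {A : Finset (Fin N) // #A = m} // IsLeast (↑A.1ᶜ : Set (Fin N)) c} =
      (N - 1 - c).choose (m - c) := by
  rw [Nat.card_congr (Equiv.subtypeSubtypeEquivSubtypeInter (fun A : Finset (Fin N) => #A = m)
    fun A => IsLeast (↑Aᶜ : Set (Fin N)) c),
    Nat.subtype_card {A ∈ powersetCard m {c}ᶜ | Iio c ⊆ A} fun A => ?_]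
  · have hsub : Iio c ⊆ {c}ᶜ := by simp
    rw [card_filter_powersetCard_subset _ _ _ hsub (by simpa using hc)]
    simp [card_compl]
  · rw [isLeast_compl_iff, mem_filter, mem_powersetCard, subset_compl_comm, singleton_subset_iff,
      mem_compl]
    tauto

end

variable {b : ℕ} (A : {A : Finset (Fin (m + (b + 1))) // #A = m}) (ρ : Equiv.Perm (Fin m))
  {ρ' : Equiv.Perm (Fin (b + 1))}

theorem isLeast_compl_splitPerm_natAdd_zero (hρ' : ρ' 0 = 0) :
    IsLeast (↑A.1ᶜ : Set (Fin (m + (b + 1)))) (splitPerm A ρ ρ' (Fin.natAdd m 0)) := by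
  rw [splitPerm_natAdd, hρ', ← range_orderEmbOfFin A.1ᶜ (card_compl_of_card_eq A)]
  exact ⟨Set.mem_range_self _, by rintro _ ⟨i, rfl⟩; simp⟩

/-- The last entry of the occurrence is the least element of `A.1ᶜ`; it exceeds as many entries of
the occurrence as there are elements below it, and all these are in `A.1`. -/
theorem occursAt_zero_splitPerm_iff (hρ' : ρ' 0 = 0) :
    OccursAt p (splitPerm A ρ ρ') 0 ↔
      IsLeast (↑A.1ᶜ : Set (Fin (m + (b + 1)))) ((p (Fin.last m)).castLE (by omega)) ∧
        ρ = initPerm p := by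
  set x := splitPerm A ρ ρ' (Fin.natAdd m 0) with hx
  have hleast : IsLeast (↑A.1ᶜ : Set (Fin (m + (b + 1)))) x :=
    isLeast_compl_splitPerm_natAdd_zero A ρ hρ'
  have hρ : StandardizesTo (fun u : Fin m => (A.1.orderEmbOfFin A.2 (ρ u) : ℕ)) ρ := fun u v => by
    simp
  have hocc : OccursAt p (splitPerm A ρ ρ') 0 ↔
      StandardizesTo (fun u : Fin m => (A.1.orderEmbOfFin A.2 (ρ u) : ℕ)) (initPerm p) ∧
        ∀ u : Fin m, (ρ u : ℕ) < x ↔ (initPerm p u : ℕ) < p (Fin.last m) := by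
    rw [OccursAt, exists_prop_of_true (by omega), standardizesTo_iff_initPerm]
    · simp only [zero_add]
      simp only [← orderEmbOfFin_lt_iff_of_isLeast_compl A.2 hleast, ← splitPerm_castAdd A ρ ρ']
      rfl
    · intro u v huv
      simpa [Fin.ext_iff] using (splitPerm A ρ ρ').injective (Fin.ext huv)
  rw [hocc, hleast.isLeast_iff_eq]
  constructor
  · rintro ⟨hinit, hlast⟩
    obtain rfl := hρ.unique hinit
    refine ⟨?_, rfl⟩
    have hxm : (x : ℕ) ≤ m := (le_card_of_isLeast_compl hleast).trans_eq A.2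
    have hpm := (p (Fin.last m)).isLt
    ext
    rw [Fin.val_castLE]
    by_contra! hne
    have := hlast ((initPerm p).symm ⟨min x (p (Fin.last m)), by omega⟩)
    rw [Equiv.apply_symm_apply] at this
    grind
  · rintro ⟨hx, rfl⟩
    refine ⟨hρ, fun u => ?_⟩
    rw [hx, Fin.val_castLE]

end PrefixOccurrence

section Chain

open Finset

variable {m : ℕ} {p : Equiv.Perm (Fin (m + 1))}

/-- The pattern `p` of length `m + 1` occurs in `σ` at the first `k` multiples of `m`, so that
adjacent ones of these occurrences share one entry. -/
def IsChained (p : Equiv.Perm (Fin (m + 1))) (k : ℕ) {n : ℕ} (σ : Equiv.Perm (Fin n)) : Prop :=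
  ∀ j < k, OccursAt p σ (j * m)

/-- The number of permutations that are covered by a chain of `k` occurrences of `p`, each of which
starts with the last entry of the preceding one. -/
noncomputable def chainCount (p : Equiv.Perm (Fin (m + 1))) (k : ℕ) : ℕ :=
  Nat.card {σ : Equiv.Perm (Fin (k * m + 1)) // IsChained p k σ}

variable (p) in
theorem chainCount_zero : chainCount p 0 = 1 := by
  have : Subsingleton (Fin (0 * m + 1)) := Fin.subsingleton_iff_le_one.mpr (by simp)
  rw [chainCount, Nat.card_eq_one_iff_unique]
  exact ⟨inferInstance, ⟨1, fun j hj => absurd hj (Nat.not_lt_zero j)⟩⟩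

theorem isChained_succ_splitPerm {b k : ℕ} (A : {A : Finset (Fin (m + b)) // #A = m})
    (ρ : Equiv.Perm (Fin m)) (ρ' : Equiv.Perm (Fin b)) :
    IsChained p (k + 1) (splitPerm A ρ ρ') ↔
      OccursAt p (splitPerm A ρ ρ') 0 ∧ IsChained p k ρ' := by
  simp only [IsChained, Nat.forall_lt_succ_left', zero_mul]
  refine and_congr_right fun _ => forall₂_congr fun j _ => ?_
  rw [← occursAt_splitPerm_right p A ρ ρ', add_mul, one_mul, add_comm (j * m)]

theorem OccursAt.apply_le (h0 : p 0 = 0) {n : ℕ} {σ : Equiv.Perm (Fin n)} {i x : ℕ}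
    (h : OccursAt p σ i) (hix : i ≤ x) (hxi : x ≤ i + m) (hxn : x < n) :
    σ ⟨i, by omega⟩ ≤ σ ⟨x, hxn⟩ := by
  rw [← not_lt, h.lt_iff hix le_rfl (by omega) (by omega)]
  simp [h0]

theorem IsChained.apply_zero_le (h0 : p 0 = 0) {k n : ℕ} {σ : Equiv.Perm (Fin n)}
    (hσ : IsChained p k σ) {x : ℕ} (hx : x ≤ k * m) (hxn : x < n) :
    σ ⟨0, by omega⟩ ≤ σ ⟨x, hxn⟩ := by
  induction k generalizing x with
  | zero =>
    obtain rfl : x = 0 := by omega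
    exact le_rfl
  | succ k ih =>
    have hinit : IsChained p k σ := fun j hj => hσ j (by omega)
    rcases le_or_gt x (k * m) with hxk | hxk
    · exact ih hinit hxk hxn
    · exact (ih hinit le_rfl (by omega)).trans
        ((hσ k (by omega)).apply_le h0 hxk.le (hx.trans_eq (Nat.succ_mul k m)) hxn)

theorem IsChained.apply_zero (h0 : p 0 = 0) {k : ℕ} {σ : Equiv.Perm (Fin (k * m + 1))}
    (hσ : IsChained p k σ) : σ 0 = 0 := by
  obtain ⟨y, hy⟩ := σ.surjective 0
  have hle := hσ.apply_zero_le h0 (Nat.lt_succ_iff.mp y.isLt) y.isLt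
  rw [Fin.eta, hy] at hle
  exact Fin.le_zero_iff.mp hle

theorem isChained_succ_splitPerm_iff (h0 : p 0 = 0) {k : ℕ}
    (A : {A : Finset (Fin (m + (k * m + 1))) // #A = m}) (ρ : Equiv.Perm (Fin m))
    (ρ' : Equiv.Perm (Fin (k * m + 1))) :
    IsChained p (k + 1) (splitPerm A ρ ρ') ↔
      IsLeast (↑A.1ᶜ : Set (Fin (m + (k * m + 1)))) ((p (Fin.last m)).castLE (by omega)) ∧
        ρ = initPerm p ∧ IsChained p k ρ' := by
  rw [isChained_succ_splitPerm, ← and_assoc]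
  exact and_congr_left fun h => occursAt_zero_splitPerm_iff p A ρ (h.apply_zero h0)

theorem chainCount_succ (h0 : p 0 = 0) (k : ℕ) :
    chainCount p (k + 1) =
      ((k + 1) * m - p (Fin.last m)).choose (m - p (Fin.last m)) * chainCount p k := by
  let firstEntries := {A : Finset (Fin (m + (k * m + 1))) // #A = m}
  let c : Fin (m + (k * m + 1)) := (p (Fin.last m)).castLE (by omega)
  let IsAdmissible (A : firstEntries) : Prop := IsLeast (↑A.1ᶜ : Set (Fin (m + (k * m + 1)))) c
  have hlen : (k + 1) * m + 1 = m + (k * m + 1) := by ring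
  have hadmissible : Nat.card {A // IsAdmissible A} =
      ((k + 1) * m - p (Fin.last m)).choose (m - p (Fin.last m)) := by
    rw [card_finset_isLeast_compl (c := c) (Nat.lt_succ_iff.mp (p (Fin.last m)).isLt),
      Fin.val_castLE, ← hlen, Nat.add_sub_cancel]
  have hsplit : {x : firstEntries × Equiv.Perm (Fin m) × Equiv.Perm (Fin (k * m + 1)) //
        IsAdmissible x.1 ∧ x.2.1 = initPerm p ∧ IsChained p k x.2.2} ≃
      {σ : Equiv.Perm (Fin (m + (k * m + 1))) // IsChained p (k + 1) σ} :=
    (Equiv.ofBijective _ (splitPerm_bijective m (k * m + 1))).subtypeEquiv fun x =>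
      (isChained_succ_splitPerm_iff h0 x.1 x.2.1 x.2.2).symm
  have hprod := (Equiv.subtypeProdEquivProd (p := IsAdmissible)
      (q := fun x : Equiv.Perm (Fin m) × _ => x.1 = initPerm p ∧ IsChained p k x.2)).trans
    ((Equiv.refl _).prodCongr (Equiv.subtypeProdEquivProd (p := fun ρ => ρ = initPerm p)
      (q := fun ρ' : Equiv.Perm (Fin (k * m + 1)) => IsChained p k ρ')))
  rw [chainCount, hlen, ← Nat.card_congr hsplit, Nat.card_congr hprod, Nat.card_prod,
    Nat.card_prod, hadmissible, Nat.card_unique (α := {ρ // ρ = initPerm p}), one_mul, chainCount]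

theorem chainCount_eq_prod (h0 : p 0 = 0) (k : ℕ) :
    chainCount p k = ∏ j ∈ Icc 1 k, (j * m - p (Fin.last m)).choose (m - p (Fin.last m)) := by
  induction k with
  | zero => simp [chainCount_zero]
  | succ k ih => rw [chainCount_succ h0, ih, prod_Icc_succ_top (by omega), mul_comm]

end Chain

section NonOverlapping

open Finset

variable {m : ℕ} {p : Equiv.Perm (Fin (m + 1))} {k : ℕ}

/-- Two occurrences of `p` in a permutation share at most one entry, where `p` has length
`m + 1`. -/
def NonOverlapping (p : Equiv.Perm (Fin (m + 1))) : Prop :=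
  ∀ (n : ℕ) (σ : Equiv.Perm (Fin n)) (i j : ℕ), i < j → j < i + m →
    OccursAt p σ i → ¬ OccursAt p σ j

theorem Cluster.pos_eq (hp : NonOverlapping p) (c : Cluster p k) (i : Fin k) :
    c.pos i = i * m := by
  obtain ⟨i, hi⟩ := i
  induction i with
  | zero => rw [c.starts _ rfl, zero_mul]
  | succ i ih =>
    have hlt := c.increasing ⟨i, by omega⟩ ⟨i + 1, hi⟩ rfl
    have hlinked := c.linked ⟨i, by omega⟩ ⟨i + 1, hi⟩ rfl
    have hge : ¬ c.pos ⟨i + 1, hi⟩ < c.pos ⟨i, by omega⟩ + m := fun hlt' =>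
      hp _ c.σ _ _ hlt hlt' (c.occurs _) (c.occurs _)
    have := ih (by omega)
    grind

theorem Cluster.length_eq (hp : NonOverlapping p) (c : Cluster p k) : c.n = k * m + 1 := by
  obtain ⟨k, rfl⟩ := Nat.exists_eq_add_one_of_ne_zero c.q_pos.ne'
  rw [c.finishes (Fin.last k) rfl, c.pos_eq hp, Fin.val_last]
  ring

/-- The cluster whose marked occurrences are at the first `k` multiples of `m`. -/
def IsChained.toCluster (hm : 0 < m) (hk : 0 < k) {σ : Equiv.Perm (Fin (k * m + 1))}
    (hσ : IsChained p k σ) : Cluster p k where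
  n := k * m + 1
  σ := σ
  pos i := i * m
  q_pos := hk
  occurs i := hσ i i.isLt
  increasing i j hij := by
    rw [← hij, Nat.succ_mul]
    omega
  linked i j hij := by
    rw [← hij, Nat.succ_mul]
    omega
  starts i hi := by rw [hi, zero_mul]
  finishes i hi := by
    have hlen := congrArg (· * m) hi
    simp only [Nat.succ_mul] at hlen
    omega

theorem card_cluster_eq_chainCount (hm : 0 < m) (hp : NonOverlapping p) (hk : 0 < k) :
    Nat.card (Cluster p k) = chainCount p k := by
  have hbij : Function.Bijective fun σ : {σ : Equiv.Perm (Fin (k * m + 1)) // IsChained p k σ} =>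
      σ.2.toCluster hm hk := by
    constructor
    · rintro ⟨σ, hσ⟩ ⟨σ', hσ'⟩ heq
      simp only [IsChained.toCluster, Cluster.mk.injEq, heq_eq_eq, true_and, and_true] at heq
      exact Subtype.ext heq
    · intro c
      have hpos : c.pos = fun i : Fin k => (i : ℕ) * m := funext (c.pos_eq hp)
      have hn := c.length_eq hp
      obtain ⟨n, σ, pos, _, hoccurs, _, _, _, _⟩ := c
      dsimp only at hpos hn
      subst hpos hn
      exact ⟨⟨σ, fun j hj => hoccurs ⟨j, hj⟩⟩, rfl⟩
  exact (Nat.card_eq_of_bijective _ hbij).symm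

theorem card_cluster_of_length_of_nonOverlapping (hp : NonOverlapping p) (n : ℕ) :
    Nat.card {c : Cluster p k // c.n = n} =
      if k * m + 1 = n then Nat.card (Cluster p k) else 0 := by
  split_ifs with hn
  · exact Nat.card_congr (Equiv.subtypeUnivEquiv fun c => (c.length_eq hp).trans hn)
  · have : IsEmpty {c : Cluster p k // c.n = n} := ⟨fun c => hn (c.1.length_eq hp ▸ c.2)⟩
    exact Nat.card_of_isEmpty

theorem card_cluster_eq_binomProduct (hm : 0 < m) (hp : NonOverlapping p) (h0 : p 0 = 0)
    (hk : 0 < k) : Nat.card (Cluster p k) = binomProduct (p (Fin.last m)) m k :=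
  (card_cluster_eq_chainCount hm hp hk).trans (chainCount_eq_prod h0 k)

theorem clusterSeries_eq_clusterTail (hm : 0 < m) (hp : NonOverlapping p) (h0 : p 0 = 0) :
    clusterSeries p = clusterTail (p (Fin.last m)) m := by
  ext1 n
  rw [clusterSeries, clusterTail, PowerSeries.coeff_mk, PowerSeries.coeff_mk, sum_filter]
  refine sum_congr rfl fun k hk => ?_
  rw [card_cluster_of_length_of_nonOverlapping hp]
  split_ifs with hn
  · rw [card_cluster_eq_binomProduct hm hp h0 (mem_Icc.mp hk).1, hn]
  · simp

theorem mainTheorem3_general {a : ℕ} (hm : 0 < m) (hp : NonOverlapping p) (h0 : p 0 = 0)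
    (ha : (p (Fin.last m) : ℕ) = a) :
    (∀ k, 1 ≤ k → Nat.card (Cluster p k) = ∏ j ∈ Icc 1 k, (j * m - a).choose (m - a)) ∧
    occurrenceSeries p * (1 - PowerSeries.X - clusterTail a m) = 1 ∧
    (∀ q : Equiv.Perm (Fin (m + 1)), NonOverlapping q → q 0 = 0 → (q (Fin.last m) : ℕ) = a →
      PatternEquivalent p q) := by
  have hseries : ∀ q : Equiv.Perm (Fin (m + 1)), NonOverlapping q → q 0 = 0 →
      (q (Fin.last m) : ℕ) = a →
      occurrenceSeries q * (1 - PowerSeries.X - clusterTail a m) = 1 := by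
    rintro q hq hq0 rfl
    rw [← clusterSeries_eq_clusterTail hm hq hq0]
    exact occurrenceSeries_mul_one_sub_clusterSeries q m.succ_pos
  refine ⟨fun k hk => ?_, hseries p hp h0 ha, fun q hq hq0 hqa => ?_⟩
  · rw [card_cluster_eq_binomProduct hm hp h0 hk, ha, binomProduct]
  · exact patternEquivalent_of_occurrenceSeries_eq
      (left_inv_eq_right_inv (hseries p hp h0 ha)
        ((mul_comm _ _).trans (hseries q hq hq0 hqa)))

end NonOverlapping

section RisePattern

variable {a m : ℕ} (h : a < m) (τ : Equiv.Perm (Fin (m - a)))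

theorem risePattern_val_of_lt {u : ℕ} (hu : u < a) :
    (risePattern h τ ⟨u, by omega⟩ : ℕ) = u := by
  simp [risePattern, riseWord, hu]

theorem lt_risePattern_val {u : ℕ} (hu : a ≤ u) (hum : u < m) :
    a < (risePattern h τ ⟨u, by omega⟩ : ℕ) := by
  simp only [risePattern, Equiv.ofBijective_apply, riseWord, not_lt.mpr hu, hum, if_false, dif_pos]
  omega

theorem risePattern_last_val : (risePattern h τ (Fin.last m) : ℕ) = a := by
  simp [risePattern, riseWord, not_lt.mpr h.le]

theorem risePattern_zero (ha : 0 < a) : risePattern h τ 0 = 0 :=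
  Fin.ext (risePattern_val_of_lt h τ ha)

theorem nonOverlapping_risePattern (ha : 0 < a) : NonOverlapping (risePattern h τ) := by
  intro n σ i j hij hji hi hj
  have hn := hj.1
  -- As one of the first `a` entries of the occurrence at `j`, the entry at `y` is less than that
  -- at `i + m`; as an entry of the part `τ` of the occurrence at `i`, it is greater.
  obtain ⟨y, hjy, hyja, hiay, hyim⟩ : ∃ y, j ≤ y ∧ y < j + a ∧ i + a ≤ y ∧ y < i + m :=
    ⟨min (j + a) (i + m) - 1, by omega⟩
  have hlt : σ ⟨y, by omega⟩ < σ ⟨i + m, by omega⟩ := by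
    rw [hj.lt_iff (by omega) (by omega) (by omega) (by omega), Fin.lt_def,
      risePattern_val_of_lt h τ (by omega)]
    rcases lt_or_ge (i + m - j) a with hima | haim
    · rw [risePattern_val_of_lt h τ hima]
      omega
    · exact lt_trans (by omega) (lt_risePattern_val h τ haim (by omega))
  have hgt : σ ⟨i + m, by omega⟩ < σ ⟨y, by omega⟩ := by
    rw [hi.lt_iff (by omega) (by omega) (by omega) (by omega), Fin.lt_def]
    have hlast : (⟨i + m - i, by omega⟩ : Fin (m + 1)) = Fin.last m :=
      Fin.ext (Nat.add_sub_cancel_left i m)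
    rw [hlast, risePattern_last_val]
    exact lt_risePattern_val h τ (by omega) (by omega)
  exact lt_asymm hlt hgt

end RisePattern

theorem mainTheorem3 (a m : ℕ) (ha : 1 ≤ a) (ham : a < m) :
    (∀ (τ : Equiv.Perm (Fin (m - a))) (k : ℕ), 1 ≤ k →
      Nat.card (Cluster (risePattern ham τ) k) =
        ∏ j ∈ Finset.Icc 1 k, (j * m - a).choose (m - a)) ∧
    (∀ τ : Equiv.Perm (Fin (m - a)),
      occurrenceSeries (risePattern ham τ) * (1 - PowerSeries.X - clusterTail a m) = 1) ∧
    (∀ τ τ' : Equiv.Perm (Fin (m - a)),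
      PatternEquivalent (risePattern ham τ) (risePattern ham τ')) := by
  have hgeneral := fun τ => mainTheorem3_general (ha.trans ham.le)
    (nonOverlapping_risePattern ham τ ha) (risePattern_zero ham τ ha) (risePattern_last_val ham τ)
  exact ⟨fun τ => (hgeneral τ).1, fun τ => (hgeneral τ).2.1, fun τ τ' => (hgeneral τ).2.2 _
    (nonOverlapping_risePattern ham τ' ha) (risePattern_zero ham τ' ha)
    (risePattern_last_val ham τ')⟩
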